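/- **Theorem 3.1.** Let $a\neq b$ be two lines in the Euclidean plane, with orthogonal reflections $T_a,T_b$. Let $K$ be a bounded open set, not necessarily connected, contained in one of the open sectors formed by $a$ and $b$ if they intersect, or in the open strip between them if they are parallel. Assume that $\partial_aK:=\partial K\cap a$ and $\partial_bK:=\partial K\cap b$ are non-empty, and let $\partial_0K:=\partial K\setminus(\partial_aK\cup\partial_bK)$ be an arbitrary union of two disjoint sets $\partial_{0,D}K$ and $\partial_{0,N}K$. Put $$\Omega_1:=\operatorname{Int}\overline{K\cup T_a(K)},\qquad \Omega_2:=\operatorname{Int}\overline{K\cup T_b(K)},$$ $$\partial_D\Omega_1:=\partial_{0,D}K\cup T_a(\partial_{0,D}K)\cup T_a(\partial_bK),\qquad \partial_N\Omega_1:=\partial_{0,N}K\cup T_a(\partial_{0,N}K)\cup\partial_bK,$$ $$\partial_D\Omega_2:=\partial_{0,D}K\cup T_b(\partial_{0,D}K)\cup\partial_aK,\qquad \partial_N\Omega_2:=\partial_{0,N}K\cup T_b(\partial_{0,N}K)\cup T_b(\partial_aK).$$ For $j=1,2$ consider the mixed problem $-\Delta u=\lambda u$ in $\Omega_j$, $u=0$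 on $\partial_D\Omega_j$, $\partial u/\partial n=0$ on $\partial_N\Omega_j$, in the usual weak sense: let $H^1_D(\Omega_j)$ be the closure in $H^1(\Omega_j)$ of the restrictions to $\Omega_j$ of all $\varphi\in C_c^\infty(\mathbb R^2)$ with $\operatorname{supp}\varphi\cap\overline{\partial_D\Omega_j}=\emptyset$ (for piecewise smooth boundaries: the $H^1$ functions with zero trace on $\partial_D\Omega_j$). For $f\in L^2(\Omega_j)$, a weak solution of $-\Delta u=f$ is a $u\in H^1_D(\Omega_j)$ with $\int_{\Omega_j}\nabla u\cdot\nabla v=\int_{\Omega_j}fv$ for all $v\in H^1_D(\Omega_j)$. The spectrum $\sigma_{DN}(\Omega_j)$ is the set of real $\lambda$ for which it is not true that for every $f\in L^2(\Omega_j)$ there is exactly one weak solution of $-\Delta u=\lambda u+f$; the multiplicity of $\lambda$ is the dimension of the space of weak solutions of $-\Delta u=\lambda u$. Then $\sigma_{DN}(\Omega_1)=\sigma_{DN}(\Omega_2)$, and every real $\lambda$ has the same multiplicity in both problems. -/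

import Mathlib

open MeasureTheory
open scoped ContDiff

/-- The Euclidean plane. -/
abbrev Plane : Type := EuclideanSpace ℝ (Fin 2)

/-! ### Mixed Dirichlet-Neumann problems and their spectra -/

/-- The data of a mixed boundary value problem: a planar set `domain` together with the part
`dirichlet` of the boundary that carries the condition `u = 0` and the part `neumann` that carries
the condition `∂u/∂n = 0`. -/
structure MixedProblem where
  domain : Set Plane
  dirichlet : Set Plane
  neumann : Set Plane

namespace MixedProblem

/-- Real square integrable functions on the domain. -/
abbrev L2 (P : MixedProblem) : Type := Lp ℝ 2 (volume.restrict P.domain)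

/-- Square integrable vector fields on the domain. -/
abbrev L2Field (P : MixedProblem) : Type := Lp Plane 2 (volume.restrict P.domain)

/-- The pairs `(φ, ∇φ)`, restricted to the domain, where `φ` is a smooth compactly supported
function on the plane whose support does not meet the closure of the Dirichlet part.
No condition is imposed on the Neumann part. -/
def testPairs (P : MixedProblem) : Submodule ℝ (P.L2 × P.L2Field) where
  carrier := {p | ∃ φ : Plane → ℝ, ContDiff ℝ ∞ φ ∧ HasCompactSupport φ ∧
    Disjoint (tsupport φ) (closure P.dirichlet) ∧
    p.1 =ᵐ[volume.restrict P.domain] φ ∧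
    p.2 =ᵐ[volume.restrict P.domain] gradient φ}
  zero_mem' := by
    refine ⟨0, contDiff_const, HasCompactSupport.zero, ?_, Lp.coeFn_zero _ _ _, ?_⟩
    · simp [tsupport]
    · refine (Lp.coeFn_zero _ _ _).trans (Filter.Eventually.of_forall fun x => ?_)
      simp [gradient]
  add_mem' := by
    rintro p q ⟨φ, h1, h2, h3, h4, h5⟩ ⟨ψ, k1, k2, k3, k4, k5⟩
    refine ⟨φ + ψ, h1.add k1, h2.add k2, ?_, (Lp.coeFn_add _ _).trans (h4.add k4), ?_⟩
    · exact (h3.union_left k3).mono_left (tsupport_add φ ψ)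
    · refine (Lp.coeFn_add _ _).trans ((h5.add k5).trans (Filter.Eventually.of_forall fun x => ?_))
      have e1 := (h1.differentiable (by simp)) x
      have e2 := (k1.differentiable (by simp)) x
      simp [gradient, fderiv_add e1 e2]
  smul_mem' := by
    rintro c p ⟨φ, h1, h2, h3, h4, h5⟩
    refine ⟨c • φ, contDiff_const.smul h1, h2.mono ?_, ?_,
      (Lp.coeFn_smul _ _).trans (h4.const_smul c), ?_⟩
    · exact Function.support_const_smul_subset c φ
    · exact h3.mono_left (closure_mono (Function.support_const_smul_subset c φ))
    · refine (Lp.coeFn_smul _ _).trans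
        ((h5.const_smul c).trans (Filter.Eventually.of_forall fun x => ?_))
      have e1 := (h1.differentiable (by simp)) x
      simp [gradient, fderiv_const_smul e1]

/-- The form domain `H¹_D(Ω)` of the mixed problem, each function being recorded together with its
weak gradient: the closure, in the norm of `H¹(Ω)`, of the smooth functions that vanish near the
Dirichlet part. For a domain with piecewise smooth boundary these are the functions in `H¹(Ω)`
with zero trace on the Dirichlet part. -/
noncomputable def formDomain (P : MixedProblem) : Submodule ℝ (P.L2 × P.L2Field) :=
  P.testPairs.topologicalClosure

/-- `P.WeakSolution u f`: the function `u` is a weak solution of `-Δu = f` in the domain, `u = 0` on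
the Dirichlet part and `∂u/∂n = 0` on the rest of the boundary (the Neumann condition is the natural
one for the form `∫ ∇u · ∇v`). In other words, `u` lies in the domain of the self-adjoint mixed
Dirichlet-Neumann Laplacian, which sends it to `f`. -/
def WeakSolution (P : MixedProblem) (u f : P.L2) : Prop :=
  ∃ g : P.L2Field, (u, g) ∈ P.formDomain ∧
    ∀ p ∈ P.formDomain, inner ℝ g p.2 = inner ℝ f p.1

/-- The space of all solutions of `-Δu = μ u` with the mixed boundary conditions. -/
noncomputable def eigenspace (P : MixedProblem) (μ : ℝ) : Submodule ℝ P.L2 where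
  carrier := {u | P.WeakSolution u (μ • u)}
  zero_mem' := ⟨0, P.formDomain.zero_mem, by simp⟩
  add_mem' := by
    rintro u v ⟨g, hg, hu⟩ ⟨h, hh, hv⟩
    refine ⟨g + h, P.formDomain.add_mem hg hh, fun p hp => ?_⟩
    rw [smul_add, inner_add_left, inner_add_left, hu p hp, hv p hp]
  smul_mem' := by
    rintro c u ⟨g, hg, hu⟩
    refine ⟨c • g, P.formDomain.smul_mem c hg, fun p hp => ?_⟩
    rw [smul_comm, real_inner_smul_left, real_inner_smul_left, hu p hp]

/-- The spectrum of the mixed Dirichlet-Neumann Laplacian: the real numbers `μ` for which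
`-Δu - μ u = f`, with the mixed boundary conditions, fails to have exactly one weak solution `u` for
some square integrable `f`. -/
def spectrum (P : MixedProblem) : Set ℝ :=
  {μ | ¬ ∀ f : P.L2, ∃! u : P.L2, P.WeakSolution u (f + μ • u)}

/-- The two mixed spectra coincide, counting multiplicities. -/
def Isospectral (P Q : MixedProblem) : Prop :=
  P.spectrum = Q.spectrum ∧
    ∀ μ : ℝ, Module.rank ℝ (P.eigenspace μ) = Module.rank ℝ (Q.eigenspace μ)

end MixedProblem

/-! ### Construction blocks -/

/-- `a` is a straight line in the plane. -/
def IsLine (a : AffineSubspace ℝ Plane) : Prop :=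
  (a : Set Plane).Nonempty ∧ Module.finrank ℝ a.direction = 1

/-- `S` is one of the (open) sectors formed by the lines `a`, `b` if they intersect, and the (open)
strip between them if they are parallel. -/
def IsSector (a b : AffineSubspace ℝ Plane) (S : Set Plane) : Prop :=
  (¬ a.Parallel b ∧ ∃ p : Plane, p ∉ a ∧ p ∉ b ∧ S = {x | a.SSameSide p x ∧ b.SSameSide p x}) ∨
  (a.Parallel b ∧ S = {x | ∃ p ∈ a, ∃ q ∈ b, Sbtw ℝ p x q})

/-- The part `∂_a K` of the boundary of `K` that lies on the line `a`. -/
def sideOn (a : AffineSubspace ℝ Plane) (K : Set Plane) : Set Plane :=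
  frontier K ∩ a

/-- The remaining part `∂₀ K` of the boundary. -/
def remainingBoundary (a b : AffineSubspace ℝ Plane) (K : Set Plane) : Set Plane :=
  frontier K \ (sideOn a K ∪ sideOn b K)

/-- Construction blocks for the two lines `a`, `b`; they need not be connected. -/
structure IsConstructionBlock (a b : AffineSubspace ℝ Plane) (K : Set Plane) : Prop where
  isOpen : IsOpen K
  isBounded : Bornology.IsBounded K
  subset_sector : ∃ S, IsSector a b S ∧ K ⊆ S
  side_left : (sideOn a K).Nonempty
  side_right : (sideOn b K).Nonempty

/-- The image of a set under the orthogonal reflection in the line `a`. -/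
noncomputable def mirror (a : AffineSubspace ℝ Plane) [Nonempty a] (X : Set Plane) : Set Plane :=
  EuclideanGeometry.reflection a '' X

/-- The set `Int (closure (K ∪ T_a K))`. -/
noncomputable def doubled (a : AffineSubspace ℝ Plane) [Nonempty a] (K : Set Plane) : Set Plane :=
  interior (closure (K ∪ mirror a K))

/-- The mixed problem on `Ω₁`, the double of `K` across `a`: the Dirichlet condition on the copy
`T_a (∂_b K)` of `∂_b K`, the Neumann condition on `∂_b K` itself. -/
noncomputable def firstProblem (a b : AffineSubspace ℝ Plane) [Nonempty a] (K D₀ N₀ : Set Plane) :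
    MixedProblem where
  domain := doubled a K
  dirichlet := D₀ ∪ mirror a D₀ ∪ mirror a (sideOn b K)
  neumann := N₀ ∪ mirror a N₀ ∪ sideOn b K

/-- The mixed problem on `Ω₂`, the double of `K` across `b`: the Dirichlet condition on `∂_a K`
itself, the Neumann condition on its copy `T_b (∂_a K)`. -/
noncomputable def secondProblem (a b : AffineSubspace ℝ Plane) [Nonempty b] (K D₀ N₀ : Set Plane) :
    MixedProblem where
  domain := doubled b K
  dirichlet := D₀ ∪ mirror b D₀ ∪ sideOn a K
  neumann := N₀ ∪ mirror b N₀ ∪ mirror b (sideOn a K)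

/-! ### Limits in L² and gradients of Lipschitz functions -/

open Filter Topology
open scoped NNReal

/-! The proof is by transplantation. Let G be the interior of the closure of K. Up to null sets, a
function u on Ω₁ is a pair (u₁, u₂) of functions on G, the restrictions of u and of u ∘ T_a;
likewise on Ω₂ with T_b. The map (u₁, u₂) ↦ ((u₁ - u₂)/√2, (u₁ + u₂)/√2) is unitary on L² and,
applied to the gradients of the halves, on vector fields. It also respects the boundary conditions.
Along a the halves of u agree, so u₁ - u₂ vanishes on ∂_a K, a Dirichlet part of Ω₂. On ∂_b K the
half u₂ vanishes, so the two new halves agree there and glue across b. The inverse map works in the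
same way with a and b exchanged. The Neumann condition is natural and imposes nothing on the form
domain. The weak equation consists of inner products only, so it is carried along once the form
domains correspond (`isospectral_of_isometry`); no compactness of the resolvent is needed.

Since K has no boundary regularity, traces are avoided: by density it suffices to transplant test
functions. The two new halves are then Lipschitz and agree near the part of the closure of K on the
mirror line. `exists_lipschitz_glue` joins them into one Lipschitz function on the plane, and
`memForm_of_lipschitz` places such a function in the form domain as soon as it vanishes on the
closed Dirichlet part. -/

theorem tendsto_Lp_two_of_bounded {α F : Type*} [MeasurableSpace α] [NormedAddCommGroup F]
    [InnerProductSpace ℝ F] {μ : Measure α} [IsFiniteMeasure μ] {f : ℕ → α → F} {g : α → F}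
    {u : ℕ → Lp F 2 μ} {v : Lp F 2 μ} (hu : ∀ n, u n =ᵐ[μ] f n) (hv : v =ᵐ[μ] g) {C : ℝ}
    (hC : ∀ n, ∀ᵐ x ∂μ, ‖f n x‖ ≤ C) (hfg : ∀ᵐ x ∂μ, Tendsto (fun n => f n x) atTop (𝓝 (g x))) :
    Tendsto u atTop (𝓝 v) := by
  have key : Tendsto (fun n => ∫ x, ‖(u n - v : Lp F 2 μ) x‖ ^ 2 ∂μ) atTop
      (𝓝 (∫ _, (0 : ℝ) ∂μ)) := by
    refine tendsto_integral_of_dominated_convergence (fun _ => (C + C) ^ 2)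
      (fun n => ((Lp.aestronglyMeasurable _).norm.pow 2)) (integrable_const _) (fun n => ?_) ?_
    · filter_upwards [Lp.coeFn_sub (u n) v, hu n, hv, ae_all_iff.2 hC, hfg] with x h1 h2 h3 h4 h5
      rw [h1, Pi.sub_apply, h2, h3, norm_pow, norm_norm]
      gcongr
      exact (norm_sub_le _ _).trans
        (add_le_add (h4 n) (le_of_tendsto h5.norm (Eventually.of_forall h4)))
    · filter_upwards [ae_all_iff.2 fun n => Lp.coeFn_sub (u n) v, ae_all_iff.2 hu, hv, hfg]
        with x h1 h2 h3 h5
      have : Tendsto (fun n => ‖f n x - g x‖ ^ 2) atTop (𝓝 (‖g x - g x‖ ^ 2)) :=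
        ((h5.sub_const _).norm.pow 2)
      simp only [sub_self, norm_zero, ne_eq, OfNat.ofNat_ne_zero, not_false_eq_true,
        zero_pow] at this
      refine this.congr fun n => ?_
      rw [h1, Pi.sub_apply, h2, h3]
  rw [tendsto_iff_norm_sub_tendsto_zero]
  have h2 : Tendsto (fun n => ‖u n - v‖ ^ 2) atTop (𝓝 0) := by
    simp only [integral_zero] at key
    refine key.congr fun n => ?_
    rw [← real_inner_self_eq_norm_sq, L2.inner_def]
    simp only [real_inner_self_eq_norm_sq]
  have := h2.sqrt
  simpa [Real.sqrt_sq] using this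

theorem norm_gradient_le_of_lipschitz {v : Plane → ℝ} {C : ℝ≥0} (hv : LipschitzWith C v)
    (x : Plane) : ‖gradient v x‖ ≤ C := by
  rw [gradient, LinearIsometryEquiv.norm_map]
  exact norm_fderiv_le_of_lipschitz ℝ hv

theorem stronglyMeasurable_gradient (v : Plane → ℝ) : StronglyMeasurable (gradient v) := by
  unfold gradient
  exact (((InnerProductSpace.toDual ℝ Plane).symm.continuous.measurable).comp
    (measurable_fderiv ℝ v)).stronglyMeasurable

theorem Filter.EventuallyEq.gradient_eq' {v w : Plane → ℝ} {x : Plane} (h : v =ᶠ[𝓝 x] w) :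
    gradient v x = gradient w x := by
  rw [gradient, gradient, h.fderiv_eq]

/-- The gradient of a Lipschitz function vanishes almost everywhere on its zero set. -/
theorem ae_gradient_eq_zero_of_eq_zero {v : Plane → ℝ} {C : ℝ≥0} (hv : LipschitzWith C v) :
    ∀ᵐ x, v x = 0 → gradient v x = 0 := by
  -- Rademacher's theorem is applied to |v|: at a zero of v it has a minimum, so where it is
  -- differentiable its derivative is zero. Then |v|, and with it v, is o(y - x).
  have habs : LipschitzWith C fun x => |v x| := by
    have := (lipschitzWith_one_norm (E := ℝ)).comp hv
    rw [one_mul] at this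
    exact this
  filter_upwards [habs.ae_differentiableAt] with x hx h0
  have hmin : IsLocalMin (fun x => |v x|) x :=
    Eventually.of_forall fun y => by simp [h0]
  have hd : HasFDerivAt (fun x => |v x|) (0 : Plane →L[ℝ] ℝ) x := by
    have := hx.hasFDerivAt
    rwa [hmin.fderiv_eq_zero] at this
  have hv0 : HasFDerivAt v (0 : Plane →L[ℝ] ℝ) x := by
    rw [hasFDerivAt_iff_isLittleO] at hd ⊢
    simp only [h0, abs_zero, sub_zero, zero_apply] at hd ⊢
    exact Asymptotics.isLittleO_abs_left.1 hd
  rw [gradient, hv0.fderiv, map_zero]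

/-! ### Lipschitz functions in the form domain -/

namespace MixedProblem

variable {P : MixedProblem}

/-- The function `v`, together with its pointwise gradient, belongs to the form domain. -/
def MemForm (P : MixedProblem) (v : Plane → ℝ) : Prop :=
  ∃ p ∈ P.formDomain, p.1 =ᵐ[volume.restrict P.domain] v ∧
    p.2 =ᵐ[volume.restrict P.domain] gradient v

/-- Dominated convergence on a set of finite measure turns the pointwise limits into L² limits of
functions and gradients, and the form domain is closed. -/
theorem memForm_of_tendsto (hfin : volume P.domain ≠ ⊤) {w : ℕ → Plane → ℝ} {v : Plane → ℝ}
    {C : ℝ≥0} {M : ℝ} (hv : LipschitzWith C v) (hw : ∀ n, P.MemForm (w n))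
    (hb : ∀ n x, |w n x| ≤ M) (hg : ∀ n x, ‖gradient (w n) x‖ ≤ C)
    (hlim : ∀ x, Tendsto (fun n => w n x) atTop (𝓝 (v x)))
    (hglim : ∀ᵐ x, Tendsto (fun n => gradient (w n) x) atTop (𝓝 (gradient v x))) :
    P.MemForm v := by
  have : IsFiniteMeasure (volume.restrict P.domain) :=
    ⟨by rw [Measure.restrict_apply_univ]; exact hfin.lt_top⟩
  have hvM : ∀ x, |v x| ≤ M := fun x =>
    le_of_tendsto (hlim x).abs (Eventually.of_forall fun n => hb n x)
  have m1 : MemLp v 2 (volume.restrict P.domain) :=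
    MemLp.of_bound hv.continuous.aestronglyMeasurable M (Eventually.of_forall hvM)
  have m2 : MemLp (gradient v) 2 (volume.restrict P.domain) :=
    MemLp.of_bound (stronglyMeasurable_gradient v).aestronglyMeasurable C
      (Eventually.of_forall (norm_gradient_le_of_lipschitz hv))
  choose p hp hp1 hp2 using hw
  refine ⟨(m1.toLp v, m2.toLp _), ?_, m1.coeFn_toLp, m2.coeFn_toLp⟩
  refine P.testPairs.isClosed_topologicalClosure.mem_of_tendsto (b := atTop) (f := p) ?_
    (Eventually.of_forall hp)
  exact (tendsto_Lp_two_of_bounded hp1 m1.coeFn_toLp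
    (fun n => Eventually.of_forall (hb n)) (Eventually.of_forall hlim)).prodMk_nhds
    (tendsto_Lp_two_of_bounded hp2 m2.coeFn_toLp
      (fun n => Eventually.of_forall (hg n)) (ae_restrict_of_ae hglim))

theorem memForm_of_contDiff {φ : Plane → ℝ} (h1 : ContDiff ℝ ∞ φ) (h2 : HasCompactSupport φ)
    (h3 : Disjoint (tsupport φ) (closure P.dirichlet)) : P.MemForm φ := by
  have m1 : MemLp φ 2 (volume.restrict P.domain) :=
    (h1.continuous.memLp_of_hasCompactSupport h2)
  have hc : Continuous (gradient φ) :=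
    (InnerProductSpace.toDual ℝ Plane).symm.continuous.comp (h1.continuous_fderiv (by simp))
  have hs : HasCompactSupport (gradient φ) :=
    (h2.fderiv ℝ).comp_left (map_zero _)
  have m2 : MemLp (gradient φ) 2 (volume.restrict P.domain) :=
    hc.memLp_of_hasCompactSupport hs
  exact ⟨(m1.toLp _, m2.toLp _), P.testPairs.le_topologicalClosure
    ⟨φ, h1, h2, h3, m1.coeFn_toLp, m2.coeFn_toLp⟩, m1.coeFn_toLp, m2.coeFn_toLp⟩

end MixedProblem

/-- Differentiation under the integral sign for the mollification of a Lipschitz function. -/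
theorem hasFDerivAt_normed_convolution (ρ : ContDiffBump (0 : Plane)) {v : Plane → ℝ} {C : ℝ≥0}
    (hv : LipschitzWith C v) (x₀ : Plane) :
    HasFDerivAt (convolution (ρ.normed volume) v (ContinuousLinearMap.lsmul ℝ ℝ) volume)
      (convolution (ρ.normed volume) (fderiv ℝ v) (ContinuousLinearMap.lsmul ℝ ℝ) volume x₀)
      x₀ := by
  have hρ : Integrable (ρ.normed (volume : Measure Plane)) := ρ.integrable_normed
  have hqmp : Measure.QuasiMeasurePreserving (fun t : Plane => x₀ - t) volume volume :=
    (Measure.measurePreserving_sub_left volume x₀).quasiMeasurePreserving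
  have hcont : ∀ x : Plane, Continuous fun t => ρ.normed volume t • v (x - t) := fun x =>
    (ρ.continuous_normed).smul (hv.continuous.comp (continuous_const.sub continuous_id))
  have := hasFDerivAt_integral_of_dominated_loc_of_lip' (μ := (volume : Measure Plane)) (𝕜 := ℝ)
    (F := fun x t => ρ.normed volume t • v (x - t))
    (F' := fun t => ρ.normed volume t • fderiv ℝ v (x₀ - t)) (x₀ := x₀) (s := Set.univ)
    (bound := fun t => ρ.normed volume t * C) univ_mem
    (fun x _ => (hcont x).aestronglyMeasurable)
    ((hcont x₀).integrable_of_hasCompactSupport (ρ.hasCompactSupport_normed.smul_right))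
    (hρ.aestronglyMeasurable.smul
      (((measurable_fderiv ℝ v).comp hqmp.measurable).aestronglyMeasurable))
    (Eventually.of_forall fun t x _ => by
      rw [← smul_sub, norm_smul, Real.norm_of_nonneg (ρ.nonneg_normed t), mul_assoc]
      gcongr
      · exact ρ.nonneg_normed t
      · refine (hv.norm_sub_le _ _).trans (le_of_eq ?_)
        congr 2
        abel)
    (hρ.mul_const _)
    (by
      -- By Rademacher's theorem v is differentiable at x₀ - t for almost every t. The derivative
      -- thus falls on v and not on the bump, which keeps the gradients of the mollifications
      -- bounded by the Lipschitz constant.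
      filter_upwards [hqmp.ae hv.ae_differentiableAt] with t ht
      have h2 : HasFDerivAt (fun x : Plane => v (x - t)) (fderiv ℝ v (x₀ - t)) x₀ := by
        have := ht.hasFDerivAt.comp x₀ ((hasFDerivAt_id x₀).sub_const t)
        rwa [ContinuousLinearMap.comp_id] at this
      exact h2.fun_const_smul _)
  exact this.2

theorem norm_normed_convolution_le (ρ : ContDiffBump (0 : Plane)) {F : Type*}
    [NormedAddCommGroup F] [NormedSpace ℝ F] {v : Plane → F} {C : ℝ} (hv : ∀ x, ‖v x‖ ≤ C)
    (x : Plane) :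
    ‖convolution (ρ.normed volume) v (ContinuousLinearMap.lsmul ℝ ℝ) volume x‖ ≤ C := by
  rw [convolution_def]
  have hρ : Integrable (ρ.normed (volume : Measure Plane)) := ρ.integrable_normed
  calc _ ≤ ∫ t, ρ.normed volume t * C := by
        refine norm_integral_le_of_norm_le (hρ.mul_const C) (Eventually.of_forall fun t => ?_)
        rw [ContinuousLinearMap.lsmul_apply, norm_smul, Real.norm_of_nonneg (ρ.nonneg_normed t)]
        gcongr
        · exact ρ.nonneg_normed t
        · exact hv _
    _ = C := by rw [integral_mul_const, ρ.integral_normed, one_mul]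

theorem tsupport_normed_convolution_subset (ρ : ContDiffBump (0 : Plane)) (v : Plane → ℝ) :
    tsupport (convolution (ρ.normed volume) v (ContinuousLinearMap.lsmul ℝ ℝ) volume) ⊆
      Metric.cthickening ρ.rOut (tsupport v) := by
  refine closure_minimal ?_ Metric.isClosed_cthickening
  refine (support_convolution_subset _).trans ?_
  rintro _ ⟨y, hy, z, hz, rfl⟩
  rw [ρ.support_normed_eq, mem_ball_zero_iff] at hy
  refine Metric.mem_cthickening_of_dist_le _ z _ _ (subset_tsupport v hz) ?_
  simpa [dist_eq_norm] using hy.le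

namespace MixedProblem

variable {P : MixedProblem}

/-- Mollification at scales below the distance from the support to the Dirichlet part gives test
functions. Their gradients are averages of the gradient of v, hence bounded and almost everywhere
convergent. -/
theorem memForm_of_lipschitz_of_disjoint (hfin : volume P.domain ≠ ⊤) {v : Plane → ℝ} {C : ℝ≥0}
    (hv : LipschitzWith C v) (hc : HasCompactSupport v)
    (hd : Disjoint (tsupport v) (closure P.dirichlet)) : P.MemForm v := by
  obtain ⟨δ, hδ, hdisj⟩ := hd.exists_cthickenings hc isClosed_closure
  obtain ⟨M, hM⟩ := hv.continuous.bounded_above_of_compact_support hc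
  let ρ : ℕ → ContDiffBump (0 : Plane) := fun n =>
    -- The outer radius is twice the inner one for every n: a bounded ratio is what the Lebesgue
    -- differentiation theorem requires of the bumps.
    ⟨δ / (n + 1) / 2, δ / (n + 1), by positivity, half_lt_self (by positivity)⟩
  have hρle : ∀ n, (ρ n).rOut ≤ δ := fun n =>
    div_le_self hδ.le (by linarith [(Nat.cast_nonneg n : (0 : ℝ) ≤ n)])
  have hρ0 : Tendsto (fun n => (ρ n).rOut) atTop (𝓝 0) :=
    tendsto_const_div_atTop_nhds_zero_nat δ |>.comp (tendsto_add_atTop_nat 1) |>.congr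
      fun n => by simp [ρ]
  let w : ℕ → Plane → ℝ := fun n =>
    convolution ((ρ n).normed volume) v (ContinuousLinearMap.lsmul ℝ ℝ) volume
  have hsub : ∀ n, tsupport (w n) ⊆ Metric.cthickening δ (tsupport v) := fun n =>
    (tsupport_normed_convolution_subset (ρ n) v).trans (Metric.cthickening_mono (hρle n) _)
  have hgrad : ∀ n x, gradient (w n) x = (InnerProductSpace.toDual ℝ Plane).symm
      (convolution ((ρ n).normed volume) (fderiv ℝ v) (ContinuousLinearMap.lsmul ℝ ℝ) volume x) :=
    fun n x => by rw [gradient, (hasFDerivAt_normed_convolution (ρ n) hv x).fderiv]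
  have hfd : ∀ x, ‖fderiv ℝ v x‖ ≤ C := fun x => norm_fderiv_le_of_lipschitz ℝ hv
  have hloc : LocallyIntegrable (fderiv ℝ v) (volume : Measure Plane) := by
    refine (locallyIntegrable_const (C : ℝ)).mono
      (measurable_fderiv ℝ v).aestronglyMeasurable (Eventually.of_forall fun x => ?_)
    simpa using hfd x
  refine memForm_of_tendsto hfin hv (w := w) (M := M) (fun n => memForm_of_contDiff ?_ ?_ ?_)
    ?_ ?_ ?_ ?_
  · exact (ρ n).hasCompactSupport_normed.contDiff_convolution_left _
      (ρ n).contDiff_normed hv.continuous.locallyIntegrable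
  · exact (hc.cthickening).of_isClosed_subset (isClosed_tsupport _) (hsub n)
  · exact hdisj.mono (hsub n) (Metric.self_subset_cthickening _)
  · exact fun n x => norm_normed_convolution_le (ρ n) hM x
  · intro n x
    rw [hgrad, LinearIsometryEquiv.norm_map]
    exact norm_normed_convolution_le (ρ n) hfd x
  · exact fun x => ContDiffBump.convolution_tendsto_right_of_continuous hρ0 hv.continuous x
  · filter_upwards [ContDiffBump.ae_convolution_tendsto_right_of_locallyIntegrable (K := 2) hρ0
      (Eventually.of_forall fun n => by simp only [ρ]; linarith) hloc] with x hx
    simp only [hgrad]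
    exact ((InnerProductSpace.toDual ℝ Plane).symm.continuous.tendsto _).comp hx

/-- Soft thresholding at height ε moves the support into {|v| ≥ ε}, a closed set away from the
Dirichlet part, and changes v by at most ε. -/
theorem memForm_of_lipschitz_of_hasCompactSupport (hfin : volume P.domain ≠ ⊤) {v : Plane → ℝ}
    {C : ℝ≥0} (hv : LipschitzWith C v) (hc : HasCompactSupport v)
    (hd : ∀ x ∈ closure P.dirichlet, v x = 0) : P.MemForm v := by
  obtain ⟨M, hM⟩ := hv.continuous.bounded_above_of_compact_support hc
  let ε : ℕ → ℝ := fun n => 1 / ((n : ℝ) + 1)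
  have hε : ∀ n, 0 < ε n := fun n => by positivity
  have hε0 : Tendsto ε atTop (𝓝 0) := tendsto_one_div_add_atTop_nhds_zero_nat
  let w : ℕ → Plane → ℝ := fun n x => v x - max (-ε n) (min (v x) (ε n))
  have hw : ∀ n, LipschitzWith (C + C) (w n) := fun n =>
    hv.sub ((hv.min_const (ε n)).const_max (-ε n))
  have hwz : ∀ n x, |v x| ≤ ε n → w n x = 0 := fun n x h => by
    obtain ⟨h1, h2⟩ := abs_le.1 h
    simp only [w, min_eq_left h2, max_eq_right h1, sub_self]
  have hwp : ∀ n x, ε n ≤ v x → w n x = v x - ε n := fun n x h => by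
    simp only [w, min_eq_right h, max_eq_right (by linarith [hε n] : -ε n ≤ ε n)]
  have hwn : ∀ n x, v x ≤ -ε n → w n x = v x - -ε n := fun n x h => by
    simp only [w, min_eq_left (by linarith [hε n] : v x ≤ ε n), max_eq_left h]
  have hwle : ∀ n x, |w n x| ≤ |v x| := fun n x => by
    rcases le_total (|v x|) (ε n) with h | h
    · rw [hwz n x h, abs_zero]; positivity
    · rcases le_abs.1 h with h | h
      · rw [hwp n x h, abs_of_nonneg (by linarith), abs_of_nonneg (by linarith [hε n])]
        linarith [hε n]
      · have h' : v x ≤ -ε n := by linarith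
        rw [hwn n x h', abs_of_nonpos (by linarith), abs_of_nonpos (by linarith [hε n])]
        linarith [hε n]
  have hdist : ∀ n x, |w n x - v x| ≤ ε n := fun n x => by
    simp only [w, sub_sub_cancel_left, abs_neg]
    exact abs_le.2 ⟨le_max_left _ _, max_le (by linarith [hε n]) (min_le_right _ _)⟩
  have hts : ∀ n, tsupport (w n) ⊆ {x | ε n ≤ |v x|} := fun n => by
    refine closure_minimal (fun x hx => ?_) (isClosed_le continuous_const hv.continuous.abs)
    by_contra h
    exact hx (hwz n x (not_le.1 h).le)
  refine memForm_of_tendsto hfin (hv.weaken le_self_add) (w := w) (M := M)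
    (fun n => memForm_of_lipschitz_of_disjoint hfin (hw n) ?_ ?_)
    (fun n x => (hwle n x).trans (hM x)) (fun n x => norm_gradient_le_of_lipschitz (hw n) x) ?_ ?_
  · refine hc.mono fun x hx h => hx ?_
    have := hwle n x
    rw [h, abs_zero] at this
    exact abs_nonpos_iff.1 this
  · refine Set.disjoint_left.2 fun x hx hx' => ?_
    have := hts n hx
    rw [Set.mem_ofPred_eq, hd x hx', abs_zero] at this
    exact absurd this (not_le.2 (hε n))
  · intro x
    rw [tendsto_iff_norm_sub_tendsto_zero]
    exact squeeze_zero (fun n => norm_nonneg _) (fun n => hdist n x) hε0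
  · filter_upwards [ae_gradient_eq_zero_of_eq_zero hv] with x hx
    by_cases h0 : v x = 0
    · rw [hx h0]
      refine tendsto_const_nhds.congr fun n => ?_
      have : w n =ᶠ[𝓝 x] fun _ => 0 := by
        have h1 : ∀ᶠ y in 𝓝 x, |v y| < ε n :=
          hv.continuous.abs.continuousAt.eventually_lt continuousAt_const (by simpa [h0] using hε n)
        filter_upwards [h1] with y hy using hwz n y hy.le
      rw [this.gradient_eq']
      simp [gradient]
    · refine tendsto_const_nhds.congr' ?_
      filter_upwards [hε0.eventually_lt_const (abs_pos.2 h0)] with n hn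
      have key : ∀ c : ℝ, (w n =ᶠ[𝓝 x] fun y => v y - c) → gradient v x = gradient (w n) x := by
        intro c hcx
        rw [hcx.gradient_eq', gradient, gradient, fderiv_sub_const]
      rcases lt_abs.1 hn with h | h
      · refine key (ε n) ?_
        filter_upwards [continuousAt_const.eventually_lt hv.continuous.continuousAt h] with y hy
          using hwp n y hy.le
      · refine key (-ε n) ?_
        filter_upwards [hv.continuous.continuousAt.eventually_lt continuousAt_const
          (by linarith : v x < -ε n)] with y hy using hwn n y hy.le

/-- On a bounded domain, a Lipschitz function that vanishes on the Dirichlet part lies in the form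
domain. -/
theorem memForm_of_lipschitz (hb : Bornology.IsBounded P.domain) {v : Plane → ℝ}
    {C : ℝ≥0} (hv : LipschitzWith C v) (hd : ∀ x ∈ closure P.dirichlet, v x = 0) :
    P.MemForm v := by
  obtain ⟨r, hr⟩ := hb.subset_ball 0
  obtain ⟨M, hM⟩ := (isCompact_closedBall (0 : Plane) r).exists_bound_of_continuousOn
    hv.continuous.continuousOn
  -- A cone of slope one, at least M on the ball and zero beyond radius r + M. Clamping v between -k
  -- and k leaves v unchanged on the ball, makes the support compact and keeps the zeros of v.
  let k : Plane → ℝ := fun x => max 0 (r + M - ‖x‖)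
  have hk : LipschitzWith (0 + 1) k :=
    ((LipschitzWith.const (r + M)).sub lipschitzWith_one_norm).const_max 0
  have hk0 : ∀ x, 0 ≤ k x := fun x => le_max_left _ _
  let w : Plane → ℝ := fun x => max (-k x) (min (v x) (k x))
  have hw : LipschitzWith _ w := hk.neg.max (hv.min hk)
  have hwv : ∀ x ∈ Metric.ball (0 : Plane) r, w x = v x := fun x hx => by
    have h1 := hM x (Metric.ball_subset_closedBall hx)
    have h2 : |v x| ≤ k x :=
      le_max_of_le_right (by rw [mem_ball_zero_iff] at hx; rw [Real.norm_eq_abs] at h1; linarith)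
    obtain ⟨h3, h4⟩ := abs_le.1 h2
    simp only [w, min_eq_left h4, max_eq_right h3]
  have hwg : ∀ x ∈ Metric.ball (0 : Plane) r, gradient w x = gradient v x := fun x hx =>
    Filter.EventuallyEq.gradient_eq'
      (by filter_upwards [Metric.isOpen_ball.mem_nhds hx] with y hy using hwv y hy)
  have hfin : volume P.domain ≠ ⊤ := hb.measure_lt_top.ne
  obtain ⟨p, hp, h1, h2⟩ := memForm_of_lipschitz_of_hasCompactSupport hfin hw
    (HasCompactSupport.intro (isCompact_closedBall (0 : Plane) (r + M)) fun x hx => by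
      have : k x = 0 := max_eq_left (by
        rw [mem_closedBall_zero_iff, not_le] at hx; linarith)
      simp only [w, this, neg_zero]
      exact max_eq_left (min_le_right _ _))
    (fun x hx => by
      simp only [w, hd x hx, min_eq_left (hk0 x), max_eq_right (neg_nonpos.2 (hk0 x))])
  have hbm : ∀ᵐ x ∂volume.restrict P.domain, x ∈ Metric.ball (0 : Plane) r :=
    ae_restrict_of_ae_restrict_of_subset hr (ae_restrict_mem Metric.isOpen_ball.measurableSet)
  refine ⟨p, hp, h1.trans ?_, h2.trans ?_⟩
  · filter_upwards [hbm] with x hx using hwv x hx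
  · filter_upwards [hbm] with x hx using hwg x hx

end MixedProblem

/-! ### Unitary equivalence of mixed problems -/

namespace MixedProblem

variable {P Q : MixedProblem}

theorem map_mem_formDomain (U : P.L2 →ₗᵢ[ℝ] Q.L2) (V : P.L2Field →ₗᵢ[ℝ] Q.L2Field)
    (h : ∀ p ∈ P.testPairs, (U p.1, V p.2) ∈ Q.formDomain) {p : P.L2 × P.L2Field}
    (hp : p ∈ P.formDomain) : (U p.1, V p.2) ∈ Q.formDomain := by
  have hc : Continuous fun p : P.L2 × P.L2Field => (U p.1, V p.2) :=
    (U.continuous.comp continuous_fst).prodMk (V.continuous.comp continuous_snd)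
  have hcl : IsClosed (Q.formDomain : Set (Q.L2 × Q.L2Field)) :=
    Q.testPairs.isClosed_topologicalClosure
  have hp' : p ∈ closure (P.testPairs : Set (P.L2 × P.L2Field)) := hp
  have := map_mem_closure (t := (Q.formDomain : Set (Q.L2 × Q.L2Field))) hc hp' fun p hp => h p hp
  rwa [hcl.closure_eq] at this

/-- The equation for `U u` is tested against all of the form domain of `Q`; each test element is
pulled back to `P`, which is why both directions `h` and `h'` are required. -/
theorem WeakSolution.map (U : P.L2 ≃ₗᵢ[ℝ] Q.L2) (V : P.L2Field ≃ₗᵢ[ℝ] Q.L2Field)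
    (h : ∀ p ∈ P.testPairs, (U p.1, V p.2) ∈ Q.formDomain)
    (h' : ∀ q ∈ Q.testPairs, (U.symm q.1, V.symm q.2) ∈ P.formDomain)
    {u f : P.L2} (hu : P.WeakSolution u f) : Q.WeakSolution (U u) (U f) := by
  obtain ⟨g, hg, hw⟩ := hu
  refine ⟨V g, map_mem_formDomain U.toLinearIsometry V.toLinearIsometry h hg, fun q hq => ?_⟩
  have := hw _ (map_mem_formDomain U.symm.toLinearIsometry V.symm.toLinearIsometry h' hq)
  simp only [LinearIsometryEquiv.coe_toLinearIsometry] at this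
  rw [← V.inner_map_map, ← U.inner_map_map] at this
  simpa using this

/-- Unitary maps that identify the form domains and respect the gradient preserve the mixed
spectrum with multiplicities. -/
theorem isospectral_of_isometry (U : P.L2 ≃ₗᵢ[ℝ] Q.L2) (V : P.L2Field ≃ₗᵢ[ℝ] Q.L2Field)
    (h : ∀ p ∈ P.testPairs, (U p.1, V p.2) ∈ Q.formDomain)
    (h' : ∀ q ∈ Q.testPairs, (U.symm q.1, V.symm q.2) ∈ P.formDomain) : Isospectral P Q := by
  have key : ∀ u f, P.WeakSolution u f ↔ Q.WeakSolution (U u) (U f) := fun u f =>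
    ⟨WeakSolution.map U V h h', fun hw => by
      simpa using hw.map U.symm V.symm h' (by simpa using h)⟩
  refine ⟨?_, fun μ => ?_⟩
  · ext μ
    refine not_congr ⟨fun H f => ?_, fun H f => ?_⟩
    · obtain ⟨u, hu, hu'⟩ := H (U.symm f)
      refine ⟨U u, by simpa using (key _ _).1 hu, fun w hw => ?_⟩
      rw [← U.symm_apply_eq]
      exact hu' _ ((key _ _).2 (by simpa using hw))
    · obtain ⟨w, hw, hw'⟩ := H (U f)
      refine ⟨U.symm w, (key _ _).2 (by simpa using hw), fun u hu => ?_⟩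
      rw [← U.symm_apply_apply u]
      exact congrArg _ (hw' _ (by simpa using (key _ _).1 hu))
  · have hmap : (P.eigenspace μ).map U.toLinearEquiv.toLinearMap = Q.eigenspace μ := by
      ext w
      constructor
      · rintro ⟨u, hu, rfl⟩
        have : P.WeakSolution u (μ • u) := hu
        change Q.WeakSolution (U u) (μ • U u)
        simpa using (key _ _).1 this
      · intro hw
        have : Q.WeakSolution w (μ • w) := hw
        refine ⟨U.symm w, ?_, by simp⟩
        exact (key _ _).2 (by simpa using this)
    rw [← hmap]
    exact (U.toLinearEquiv.submoduleMap (P.eigenspace μ)).rank_eq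

end MixedProblem

/-! ### Unfolding a symmetric domain into two halves -/

section Unfold

variable {F : Type*} [NormedAddCommGroup F] [InnerProductSpace ℝ F]

/-- Restriction of square integrable functions to a smaller set. -/
noncomputable def restrictLp {S Ω : Set Plane} (h : S ⊆ Ω) :
    Lp F 2 (volume.restrict Ω) →ₗ[ℝ] Lp F 2 (volume.restrict S) where
  toFun u := ((Lp.memLp u).mono_measure (Measure.restrict_mono h le_rfl)).toLp u
  map_add' u v := by
    rw [← MemLp.toLp_add]
    exact (MemLp.toLp_eq_toLp_iff _ _).2
      ((Lp.coeFn_add u v).filter_mono (ae_mono (Measure.restrict_mono h le_rfl)))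
  map_smul' c u := by
    rw [RingHom.id_apply, ← MemLp.toLp_const_smul]
    exact (MemLp.toLp_eq_toLp_iff _ _).2
      ((Lp.coeFn_smul c u).filter_mono (ae_mono (Measure.restrict_mono h le_rfl)))

theorem coeFn_restrictLp {S Ω : Set Plane} (h : S ⊆ Ω) (u : Lp F 2 (volume.restrict Ω)) :
    restrictLp h u =ᵐ[volume.restrict S] u :=
  ((Lp.memLp u).mono_measure (Measure.restrict_mono h le_rfl)).coeFn_toLp

/-- A square integrable function on a set that is symmetric under an involution `T` is a pair of
square integrable functions on one half `G` of the set. -/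
theorem exists_unfold (T : Plane ≃ₜ Plane) (hT : MeasurePreserving T volume volume)
    (hinv : ∀ x, T (T x) = x) (A : F ≃ₗᵢ[ℝ] F) {G Ω : Set Plane} (hG : MeasurableSet G)
    (h1 : G ⊆ Ω) (h2 : T ⁻¹' G ⊆ Ω) (hΩ : Ω =ᵐ[volume] (G ∪ T ⁻¹' G : Set Plane))
    (hd : AEDisjoint volume G (T ⁻¹' G)) :
    ∃ J : Lp F 2 (volume.restrict Ω) ≃ₗ[ℝ]
        (Lp F 2 (volume.restrict G) × Lp F 2 (volume.restrict G)),
      (∀ (u : Lp F 2 (volume.restrict Ω)) (f : Plane → F), u =ᵐ[volume.restrict Ω] f →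
        (J u).1 =ᵐ[volume.restrict G] f ∧
        (J u).2 =ᵐ[volume.restrict G] fun x => A (f (T x))) ∧
      ∀ u v, inner ℝ u v = inner ℝ (J u).1 (J v).1 + inner ℝ (J u).2 (J v).2 := by
  have hTT : T ⁻¹' (T ⁻¹' G) = G := by ext x; simp [hinv]
  have hTG : MeasurePreserving T (volume.restrict G) (volume.restrict (T ⁻¹' G)) := by
    have := hT.restrict_preimage (s := T ⁻¹' G) (T.continuous.measurable hG)
    rwa [hTT] at this
  let J : Lp F 2 (volume.restrict Ω) →ₗ[ℝ]
        (Lp F 2 (volume.restrict G) × Lp F 2 (volume.restrict G)) :=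
    (restrictLp h1).prod
      ((A.toContinuousLinearEquiv.toContinuousLinearMap.compLpL 2
          (volume.restrict G)).toLinearMap ∘ₗ
        (Lp.compMeasurePreservingₗ ℝ T hTG) ∘ₗ (restrictLp h2))
  have hJ1 : ∀ (u : Lp F 2 (volume.restrict Ω)) (f : Plane → F), u =ᵐ[volume.restrict Ω] f →
        (J u).1 =ᵐ[volume.restrict G] f ∧
        (J u).2 =ᵐ[volume.restrict G] fun x => A (f (T x)) := by
    intro u f hu
    refine ⟨(coeFn_restrictLp h1 u).trans
      (hu.filter_mono (ae_mono (Measure.restrict_mono h1 le_rfl))), ?_⟩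
    have e1 := (coeFn_restrictLp h2 u).trans
      (hu.filter_mono (ae_mono (Measure.restrict_mono h2 le_rfl)))
    have e2 := Lp.coeFn_compMeasurePreserving (restrictLp h2 u) hTG
    have e3 := A.toContinuousLinearEquiv.toContinuousLinearMap.coeFn_compLp'
      (Lp.compMeasurePreserving T hTG (restrictLp h2 u))
    have e4 := hTG.quasiMeasurePreserving.ae_eq_comp e1
    filter_upwards [e2, e3, e4] with x k2 k3 k4
    change (A.toContinuousLinearEquiv.toContinuousLinearMap.compLp
      (Lp.compMeasurePreserving T hTG (restrictLp h2 u))) x = _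
    rw [k3, k2, k4]
    rfl
  have hJ2 : ∀ u v, inner ℝ u v = inner ℝ (J u).1 (J v).1 + inner ℝ (J u).2 (J v).2 := by
    intro u v
    obtain ⟨u1, u2⟩ := hJ1 u u (ae_eq_refl _)
    obtain ⟨v1, v2⟩ := hJ1 v v (ae_eq_refl _)
    have hi : Integrable (fun x => inner ℝ (u x) (v x)) (volume.restrict Ω) :=
      L2.integrable_inner u v
    have hT' : ∫ x in T ⁻¹' G, inner ℝ (u x) (v x) = ∫ x in G, inner ℝ (u (T x)) (v (T x)) :=
      (hTG.integral_comp T.measurableEmbedding (fun x => inner ℝ (u x) (v x))).symm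
    rw [L2.inner_def, L2.inner_def, L2.inner_def, setIntegral_congr_set hΩ,
      Measure.restrict_union₀ hd (T.continuous.measurable hG).nullMeasurableSet,
      integral_add_measure (hi.mono_measure (Measure.restrict_mono h1 le_rfl))
        (hi.mono_measure (Measure.restrict_mono h2 le_rfl)), hT']
    congr 1
    · refine integral_congr_ae ?_
      filter_upwards [u1, v1] with x k1 k2
      rw [k1, k2]
    · refine integral_congr_ae ?_
      filter_upwards [u2, v2] with x k1 k2
      rw [k1, k2, A.inner_map_map]
  have hinj : Function.Injective J := by
    refine (injective_iff_map_eq_zero J).2 fun u hu => ?_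
    have := hJ2 u u
    rw [hu] at this
    simpa using this
  have hsurj : Function.Surjective J := by
    rintro ⟨f₁, f₂⟩
    -- The preimage of (f₁, f₂) is f₁ on G plus A⁻¹ f₂ transported to the mirror image of G.
    have m1 : MemLp (G.indicator f₁) 2 volume := (memLp_indicator_iff_restrict hG).2 (Lp.memLp f₁)
    have m2 : MemLp ((G.indicator fun x => A.symm (f₂ x)) ∘ T) 2 volume :=
      ((memLp_indicator_iff_restrict hG).2
        (A.symm.toContinuousLinearEquiv.toContinuousLinearMap.comp_memLp f₂)).comp_measurePreserving
        hT
    have m : MemLp (G.indicator f₁ + (G.indicator fun x => A.symm (f₂ x)) ∘ T) 2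
        (volume.restrict Ω) := (m1.add m2).restrict Ω
    obtain ⟨k1, k2⟩ := hJ1 (m.toLp _) _ m.coeFn_toLp
    have hne : ∀ᵐ x ∂volume.restrict G, T x ∉ G := by
      rw [ae_restrict_iff' hG]
      have : volume {x | ¬ (x ∈ G → T x ∉ G)} = 0 := by
        rw [← hd]
        congr 1
        ext x
        simp
      exact this
    refine ⟨m.toLp _, Prod.ext (Lp.ext (k1.trans ?_)) (Lp.ext (k2.trans ?_))⟩
    · filter_upwards [hne, ae_restrict_mem hG] with x hx hxG
      simp [hx, hxG]
    · filter_upwards [hne, ae_restrict_mem hG] with x hx hxG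
      simp [hx, hxG, hinv]
  exact ⟨LinearEquiv.ofBijective J ⟨hinj, hsurj⟩, hJ1, hJ2⟩

/-- The rotation by an eighth of a turn on pairs. -/
noncomputable def eighthRotation (H : Type*) [AddCommGroup H] [Module ℝ H] :
    (H × H) ≃ₗ[ℝ] (H × H) where
  toFun x := ((√2)⁻¹ • (x.1 - x.2), (√2)⁻¹ • (x.1 + x.2))
  invFun x := ((√2)⁻¹ • (x.1 + x.2), (√2)⁻¹ • (x.2 - x.1))
  map_add' x y := by
    ext <;> simp only [Prod.fst_add, Prod.snd_add] <;> module
  map_smul' c x := by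
    ext <;> simp only [Prod.smul_fst, Prod.smul_snd, RingHom.id_apply] <;> module
  left_inv x := by
    have h : (√2)⁻¹ * (√2)⁻¹ * 2 = (1 : ℝ) := by
      rw [← mul_inv, Real.mul_self_sqrt (by norm_num)]; norm_num
    ext
    · linear_combination (norm := module) h • x.1
    · linear_combination (norm := module) h • x.2
  right_inv x := by
    have h : (√2)⁻¹ * (√2)⁻¹ * 2 = (1 : ℝ) := by
      rw [← mul_inv, Real.mul_self_sqrt (by norm_num)]; norm_num
    ext
    · linear_combination (norm := module) h • x.1
    · linear_combination (norm := module) h • x.2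

theorem inner_eighthRotation {H : Type*} [NormedAddCommGroup H] [InnerProductSpace ℝ H]
    (x y : H × H) :
    inner ℝ (eighthRotation H x).1 (eighthRotation H y).1 +
      inner ℝ (eighthRotation H x).2 (eighthRotation H y).2 =
    inner ℝ x.1 y.1 + inner ℝ x.2 y.2 := by
  have h : (√2)⁻¹ * (√2)⁻¹ * 2 = (1 : ℝ) := by
    rw [← mul_inv, Real.mul_self_sqrt (by norm_num)]; norm_num
  simp only [eighthRotation, LinearEquiv.coe_mk, LinearMap.coe_mk, AddHom.coe_mk,
    real_inner_smul_left, real_inner_smul_right, inner_add_left, inner_add_right, inner_sub_left,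
    inner_sub_right]
  linear_combination (inner ℝ x.1 y.1 + inner ℝ x.2 y.2) * h

end Unfold

/-! ### Geometry of the double and gluing across the mirror -/

theorem interior_closure_subset_double (T : Plane ≃ᵃⁱ[ℝ] Plane) (K : Set Plane) :
    interior (closure K) ⊆ interior (closure (K ∪ T '' K)) :=
  interior_mono (closure_mono Set.subset_union_left)

/-- `s` is a signed distance to the mirror line of the reflection `T`, with unit normal `n`. -/
structure IsSignedDistance (T : Plane ≃ᵃⁱ[ℝ] Plane) (s : Plane → ℝ) (n : Plane) : Prop where
  lipschitz : LipschitzWith 1 s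
  add_smul : ∀ x t, s (x + t • n) = s x + t
  apply : ∀ x, T x = x - (2 * s x) • n
  null : volume {x | s x = 0} = 0

namespace IsSignedDistance

variable {T : Plane ≃ᵃⁱ[ℝ] Plane} {s : Plane → ℝ} {n : Plane}

theorem map_apply (h : IsSignedDistance T s n) (x : Plane) : s (T x) = -s x := by
  rw [h.apply, sub_eq_add_neg, ← neg_smul, h.add_smul]
  ring

theorem involutive (h : IsSignedDistance T s n) (x : Plane) : T (T x) = x := by
  rw [h.apply (T x), h.map_apply, h.apply x]
  module

theorem apply_eq_self (h : IsSignedDistance T s n) {x : Plane} (hx : s x = 0) : T x = x := by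
  simp [h.apply, hx]

theorem nonneg_of_mem_closure (h : IsSignedDistance T s n) {K : Set Plane} (hK : ∀ x ∈ K, 0 < s x) {x : Plane}
    (hx : x ∈ closure K) : 0 ≤ s x :=
  closure_minimal (fun x hx => (hK x hx).le)
    (isClosed_le continuous_const h.lipschitz.continuous) hx

/-- A small step against the normal stays in the closure of K, where s ≥ 0, and lowers s strictly.
-/
theorem pos_of_mem_interior (h : IsSignedDistance T s n) {K : Set Plane} (hK : ∀ x ∈ K, 0 < s x) {x : Plane}
    (hx : x ∈ interior (closure K)) : 0 < s x := by
  have hc : Tendsto (fun t : ℝ => x + t • n) (𝓝[<] 0) (𝓝 x) := by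
    have : Continuous fun t : ℝ => x + t • n := by fun_prop
    simpa using (this.tendsto 0).mono_left nhdsWithin_le_nhds
  obtain ⟨t, ht, ht0⟩ := ((hc.eventually (isOpen_interior.mem_nhds hx)).and
    self_mem_nhdsWithin).exists
  have := h.nonneg_of_mem_closure hK (interior_subset ht)
  rw [h.add_smul] at this
  have ht0' : t < 0 := ht0
  linarith

theorem closure_union_image (h : IsSignedDistance T s n) (K : Set Plane) :
    closure (K ∪ T '' K) = closure K ∪ T ⁻¹' closure K := by
  have himg : closure (T '' K) = T '' closure K := (T.toHomeomorph.image_closure K).symm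
  rw [closure_union, himg]
  congr 1
  ext x
  constructor
  · rintro ⟨y, hy, rfl⟩
    change T (T y) ∈ closure K
    rwa [h.involutive]
  · intro hx
    exact ⟨T x, hx, h.involutive x⟩

theorem preimage_interior_subset_double (h : IsSignedDistance T s n) (K : Set Plane) :
    T ⁻¹' interior (closure K) ⊆ interior (closure (K ∪ T '' K)) := by
  refine interior_maximal ?_ (isOpen_interior.preimage T.continuous)
  rw [h.closure_union_image]
  exact (Set.preimage_mono interior_subset).trans Set.subset_union_right

theorem mem_interior_of_mem_double (h : IsSignedDistance T s n) {K : Set Plane} (hK : ∀ x ∈ K, 0 < s x) {x : Plane}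
    (hx : x ∈ interior (closure (K ∪ T '' K))) (hs : 0 < s x) : x ∈ interior (closure K) := by
  rw [mem_interior_iff_mem_nhds] at hx ⊢
  filter_upwards [hx, continuousAt_const.eventually_lt h.lipschitz.continuous.continuousAt hs]
    with y hy hys
  rw [h.closure_union_image] at hy
  refine hy.resolve_right fun hy => ?_
  have := h.nonneg_of_mem_closure hK hy
  rw [h.map_apply] at this
  linarith

theorem apply_mem_double (h : IsSignedDistance T s n) {K : Set Plane} {x : Plane}
    (hx : x ∈ interior (closure (K ∪ T '' K))) : T x ∈ interior (closure (K ∪ T '' K)) := by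
  have hsub : T ⁻¹' interior (closure (K ∪ T '' K)) ⊆ interior (closure (K ∪ T '' K)) := by
    refine interior_maximal ?_ (isOpen_interior.preimage T.continuous)
    refine (Set.preimage_mono interior_subset).trans ?_
    rw [h.closure_union_image]
    rintro y (hy | hy)
    · exact Or.inr hy
    · rw [Set.mem_preimage, h.involutive] at hy
      exact Or.inl hy
  refine hsub ?_
  rwa [Set.mem_preimage, h.involutive]

/-- The mirror line is null, and off it a point of the double is interior to exactly one copy of the
closure of K. The halves are interiors of closures rather than K itself, since ∂K may have positive
measure. -/
theorem double_ae_eq (h : IsSignedDistance T s n) {K : Set Plane} (hK : ∀ x ∈ K, 0 < s x) :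
    interior (closure (K ∪ T '' K)) =ᵐ[volume]
      (interior (closure K) ∪ T ⁻¹' interior (closure K) : Set Plane) := by
  have hae : ∀ᵐ x, s x ≠ 0 := by
    have := h.null
    rw [ae_iff]
    simpa using this
  filter_upwards [hae] with x hx
  refine propext ⟨fun hm => ?_, fun hm => ?_⟩
  · rcases lt_or_gt_of_ne hx with hx | hx
    · exact Or.inr (h.mem_interior_of_mem_double hK (h.apply_mem_double hm)
        (by rw [h.map_apply]; linarith))
    · exact Or.inl (h.mem_interior_of_mem_double hK hm hx)
  · rcases hm with hm | hm
    · exact interior_closure_subset_double T K hm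
    · exact h.preimage_interior_subset_double K hm

theorem disjoint_preimage (h : IsSignedDistance T s n) {K : Set Plane} (hK : ∀ x ∈ K, 0 < s x) :
    Disjoint (interior (closure K)) (T ⁻¹' interior (closure K)) := by
  refine Set.disjoint_left.2 fun x hx hx' => ?_
  have h1 := h.pos_of_mem_interior hK hx
  have h2 := h.pos_of_mem_interior hK hx'
  rw [h.map_apply] at h2
  linarith

/-- Two Lipschitz functions that agree near the part of `C` on the mirror can be glued along the
mirror, as far as their values on `C` are concerned. -/
theorem exists_lipschitz_glue (h : IsSignedDistance T s n) {C : Set Plane} (hC : IsCompact C) (hs : ∀ x ∈ C, 0 ≤ s x)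
    {φ₁ φ₂ : Plane → ℝ} {C₁ C₂ : ℝ≥0} (h₁ : LipschitzWith C₁ φ₁) (h₂ : LipschitzWith C₂ φ₂)
    (hd : Disjoint (tsupport (φ₁ - φ₂)) (C ∩ {x | s x = 0})) :
    ∃ (c : ℝ≥0) (v : Plane → ℝ), LipschitzWith c v ∧ (∀ x ∈ C, v x = φ₁ x) ∧
      ∀ x ∈ C, v (T x) = φ₂ x := by
  -- By compactness s ≥ δ > 0 on the points of C in the support of φ₁ - φ₂. Hence the ramp k below,
  -- of slope |M|/δ, dominates |φ₁ - φ₂| on all of C.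
  obtain ⟨δ, hδ, hδs⟩ := (hC.inter_right (isClosed_tsupport (φ₁ - φ₂))).exists_forall_le'
    (f := s) h.lipschitz.continuous.continuousOn (a := 0) fun x hx =>
      (hs x hx.1).lt_of_ne fun h0 => Set.disjoint_left.1 hd hx.2 ⟨hx.1, h0.symm⟩
  obtain ⟨M, hM⟩ := hC.exists_bound_of_continuousOn (h₁.sub h₂).continuous.continuousOn
  let N : ℝ := |M| / δ
  have hN : 0 ≤ N := by positivity
  let k : Plane → ℝ := fun x => N * max 0 (s x)
  have hk : LipschitzWith (‖N‖₊ * 1) k :=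
    (lipschitzWith_smul N).comp (h.lipschitz.const_max 0)
  have hk0 : ∀ x, 0 ≤ k x := fun x => mul_nonneg hN (le_max_left _ _)
  -- The identity where s ≥ 0 and the reflection where s ≤ 0, so φ₂ ∘ fold is the even extension of
  -- φ₂.
  let fold : Plane → Plane := fun x => x + (max 0 (-s x)) • ((2 : ℝ) • n)
  have hfold : LipschitzWith _ fold := LipschitzWith.id.add
    (((ContinuousLinearMap.toSpanSingleton ℝ ((2 : ℝ) • n)).lipschitz).comp
      (h.lipschitz.neg.const_max 0))
  -- The correction from φ₂ to φ₁, clamped by the ramp: on C it is exactly φ₁ - φ₂, and it vanishes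
  -- beyond the mirror.
  let w : Plane → ℝ := fun x => max (-k x) (min (φ₁ x - φ₂ x) (k x))
  refine ⟨_, fun x => φ₂ (fold x) + w x,
    (h₂.comp hfold).add (hk.neg.max ((h₁.sub h₂).min hk)), fun x hx => ?_, fun x hx => ?_⟩
  · have hf : fold x = x := by
      simp [fold, max_eq_left (neg_nonpos.2 (hs x hx))]
    have hle : |φ₁ x - φ₂ x| ≤ k x := by
      by_cases h0 : φ₁ x - φ₂ x = 0
      · rw [h0, abs_zero]; exact hk0 x
      · have hδx : δ ≤ s x := hδs x ⟨hx, subset_tsupport _ h0⟩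
        calc |φ₁ x - φ₂ x| ≤ |M| := (hM x hx).trans (le_abs_self M)
          _ = N * δ := by simp only [N]; field_simp
          _ ≤ N * max 0 (s x) := by gcongr; exact hδx.trans (le_max_right _ _)
    obtain ⟨h3, h4⟩ := abs_le.1 hle
    simp only [w, hf, min_eq_left h4, max_eq_right h3]
    ring
  · have hf : fold (T x) = x := by
      simp only [fold, h.map_apply, neg_neg, max_eq_right (hs x hx)]
      rw [h.apply]
      module
    have hkx : k (T x) = 0 := by
      simp [k, h.map_apply, max_eq_left (neg_nonpos.2 (hs x hx))]
    simp only [w, hf, hkx, neg_zero, add_eq_left]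
    exact max_eq_left (min_le_right _ _)

end IsSignedDistance

theorem affineIsometryEquiv_eq_add (T : Plane ≃ᵃⁱ[ℝ] Plane) :
    (T : Plane → Plane) = fun z => T.linearIsometryEquiv z + T 0 := by
  ext1 z
  simpa using T.map_vadd 0 z

theorem measurePreserving_affineIsometryEquiv (T : Plane ≃ᵃⁱ[ℝ] Plane) :
    MeasurePreserving T volume volume := by
  rw [affineIsometryEquiv_eq_add T]
  exact (measurePreserving_add_right volume (T 0)).comp
    T.linearIsometryEquiv.measurePreserving

theorem gradient_comp_affineIsometryEquiv (T : Plane ≃ᵃⁱ[ℝ] Plane) (v : Plane → ℝ) (x : Plane) :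
    gradient (fun y => v (T y)) x = T.linearIsometryEquiv.symm (gradient v (T x)) := by
  have hT : ∀ (S : Plane ≃ᵃⁱ[ℝ] Plane) (y : Plane), HasFDerivAt S
      (S.linearIsometryEquiv.toContinuousLinearEquiv : Plane →L[ℝ] Plane) y := fun S y => by
    rw [affineIsometryEquiv_eq_add S]
    exact (S.linearIsometryEquiv.toContinuousLinearEquiv.hasFDerivAt).add_const _
  by_cases hd : DifferentiableAt ℝ v (T x)
  · have h2 := hd.hasFDerivAt.comp x (hT T x)
    have h3 : HasFDerivAt (fun y => v (T y)) _ x := h2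
    refine ext_inner_right ℝ fun z => ?_
    rw [gradient, h3.fderiv, InnerProductSpace.toDual_symm_apply,
      ← LinearIsometryEquiv.inner_map_map T.linearIsometryEquiv,
      LinearIsometryEquiv.apply_symm_apply, gradient, InnerProductSpace.toDual_symm_apply]
    rfl
  · have hd' : ¬ DifferentiableAt ℝ (fun y => v (T y)) x := fun hx => hd <| by
      have hx' : DifferentiableAt ℝ (fun y => v (T y)) (T.symm (T x)) := by simpa using hx
      have := hx'.comp (T x) (hT T.symm (T x)).differentiableAt
      simpa [Function.comp_def] using this
    rw [gradient, gradient, fderiv_zero_of_not_differentiableAt hd,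
      fderiv_zero_of_not_differentiableAt hd', map_zero, map_zero]

/-! ### Unfolding a mixed problem -/

namespace MixedProblem

variable {P : MixedProblem}

/-- `J` and `J'` represent square integrable functions and vector fields on the domain as pairs of
such objects on `G`, by means of the isometry `T`. -/
structure IsUnfolding (P : MixedProblem) (T : Plane ≃ᵃⁱ[ℝ] Plane) (G : Set Plane)
    (J : P.L2 ≃ₗ[ℝ] (Lp ℝ 2 (volume.restrict G) × Lp ℝ 2 (volume.restrict G)))
    (J' : P.L2Field ≃ₗ[ℝ] (Lp Plane 2 (volume.restrict G) × Lp Plane 2 (volume.restrict G))) :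
    Prop where
  scalar : ∀ (u : P.L2) (f : Plane → ℝ), u =ᵐ[volume.restrict P.domain] f →
    (J u).1 =ᵐ[volume.restrict G] f ∧ (J u).2 =ᵐ[volume.restrict G] fun x => f (T x)
  field : ∀ (g : P.L2Field) (f : Plane → ℝ), g =ᵐ[volume.restrict P.domain] gradient f →
    (J' g).1 =ᵐ[volume.restrict G] gradient f ∧
      (J' g).2 =ᵐ[volume.restrict G] gradient fun x => f (T x)
  inner_scalar : ∀ u v, inner ℝ u v = inner ℝ (J u).1 (J v).1 + inner ℝ (J u).2 (J v).2
  inner_field : ∀ u v, inner ℝ u v = inner ℝ (J' u).1 (J' v).1 + inner ℝ (J' u).2 (J' v).2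

variable {T : Plane ≃ᵃⁱ[ℝ] Plane} {s : Plane → ℝ} {n : Plane} {K : Set Plane}

theorem exists_isUnfolding (h : IsSignedDistance T s n) (hK : ∀ x ∈ K, 0 < s x)
    (hdom : P.domain = interior (closure (K ∪ T '' K))) :
    ∃ J J', P.IsUnfolding T (interior (closure K)) J J' := by
  have hT : MeasurePreserving T.toHomeomorph volume volume :=
    measurePreserving_affineIsometryEquiv T
  have h1 : interior (closure K) ⊆ P.domain := hdom ▸ interior_closure_subset_double T K
  have h2 : T.toHomeomorph ⁻¹' interior (closure K) ⊆ P.domain :=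
    hdom ▸ h.preimage_interior_subset_double K
  have h3 : P.domain =ᵐ[volume]
      (interior (closure K) ∪ T.toHomeomorph ⁻¹' interior (closure K) : Set Plane) :=
    hdom ▸ h.double_ae_eq hK
  have hd := (h.disjoint_preimage hK).aedisjoint (μ := volume)
  obtain ⟨J, hJ, hJi⟩ := exists_unfold T.toHomeomorph hT h.involutive
    (LinearIsometryEquiv.refl ℝ ℝ) isOpen_interior.measurableSet h1 h2 h3 hd
  obtain ⟨J', hJ', hJi'⟩ := exists_unfold T.toHomeomorph hT h.involutive
    T.linearIsometryEquiv.symm isOpen_interior.measurableSet h1 h2 h3 hd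
  refine ⟨J, J', hJ, fun g f hg => ⟨(hJ' g _ hg).1, (hJ' g _ hg).2.trans ?_⟩, hJi, hJi'⟩
  exact Eventually.of_forall fun x => (gradient_comp_affineIsometryEquiv T f x).symm

/-- The glued function is Lipschitz, and each Dirichlet point may be checked on whichever half
contains it. Equality on the open set G passes to the gradients. -/
theorem IsUnfolding.exists_mem_formDomain {J J'}
    (hJ : P.IsUnfolding T (interior (closure K)) J J')
    (h : IsSignedDistance T s n) (hK : ∀ x ∈ K, 0 < s x) (hb : Bornology.IsBounded K)
    (hdom : P.domain = interior (closure (K ∪ T '' K))) {φ₁ φ₂ : Plane → ℝ} {C₁ C₂ : ℝ≥0}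
    (h₁ : LipschitzWith C₁ φ₁) (h₂ : LipschitzWith C₂ φ₂)
    (hd : Disjoint (tsupport (φ₁ - φ₂)) (closure K ∩ {x | s x = 0}))
    (hdir : ∀ x ∈ closure P.dirichlet,
      (x ∈ closure K ∧ φ₁ x = 0) ∨ (T x ∈ closure K ∧ φ₂ (T x) = 0)) :
    ∃ q ∈ P.formDomain,
      ((J q.1).1 =ᵐ[volume.restrict (interior (closure K))] φ₁ ∧
        (J q.1).2 =ᵐ[volume.restrict (interior (closure K))] φ₂) ∧
      (J' q.2).1 =ᵐ[volume.restrict (interior (closure K))] gradient φ₁ ∧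
        (J' q.2).2 =ᵐ[volume.restrict (interior (closure K))] gradient φ₂ := by
  obtain ⟨c, v, hv, hv1, hv2⟩ := h.exists_lipschitz_glue hb.isCompact_closure
    (fun x hx => h.nonneg_of_mem_closure hK hx) h₁ h₂ hd
  have hbd : Bornology.IsBounded P.domain := by
    rw [hdom]
    refine Bornology.IsBounded.subset ?_ interior_subset
    exact (hb.union (T.lipschitz.isBounded_image hb)).closure
  obtain ⟨q, hq, hq1, hq2⟩ := memForm_of_lipschitz hbd hv fun x hx => by
    rcases hdir x hx with ⟨hx1, hx2⟩ | ⟨hx1, hx2⟩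
    · rw [hv1 x hx1, hx2]
    · rw [← h.involutive x, hv2 _ hx1, hx2]
  have hG := ae_restrict_mem (μ := volume) (isOpen_interior (s := closure K)).measurableSet
  obtain ⟨k1, k2⟩ := hJ.scalar _ _ hq1
  obtain ⟨k3, k4⟩ := hJ.field _ _ hq2
  refine ⟨q, hq, ⟨k1.trans ?_, k2.trans ?_⟩, k3.trans ?_, k4.trans ?_⟩
  · filter_upwards [hG] with x hx using hv1 x (interior_subset hx)
  · filter_upwards [hG] with x hx using hv2 x (interior_subset hx)
  · filter_upwards [hG] with x hx
    refine Filter.EventuallyEq.gradient_eq' ?_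
    filter_upwards [isOpen_interior.mem_nhds hx] with y hy using hv1 y (interior_subset hy)
  · filter_upwards [hG] with x hx
    refine Filter.EventuallyEq.gradient_eq' ?_
    filter_upwards [isOpen_interior.mem_nhds hx] with y hy using hv2 y (interior_subset hy)

end MixedProblem

/-! ### Normals to lines and sides of sectors -/

theorem exists_unit_normal {V : Submodule ℝ Plane} (hV : Module.finrank ℝ V = 1) :
    ∃ n : Plane, ‖n‖ = 1 ∧ (∀ v, v ∈ V ↔ inner ℝ n v = 0) ∧
      ∀ v, V.reflection v = v - (2 * inner ℝ n v) • n := by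
  have h1 : Module.finrank ℝ Vᗮ = 1 := by
    have := V.finrank_add_finrank_orthogonal
    rw [hV, finrank_euclideanSpace_fin] at this
    omega
  obtain ⟨⟨m, hm⟩, hm0, hspan⟩ := finrank_eq_one_iff'.1 h1
  have hm0' : m ≠ 0 := fun h => hm0 (by simpa using h)
  have hn : ‖‖m‖⁻¹ • m‖ = 1 := norm_smul_inv_norm (𝕜 := ℝ) hm0'
  have hnV : ‖m‖⁻¹ • m ∈ Vᗮ := Vᗮ.smul_mem _ hm
  have hmem : ∀ v, v ∈ V ↔ inner ℝ (‖m‖⁻¹ • m) v = 0 := fun v => by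
    refine ⟨fun hv => by rw [real_inner_comm]; exact hnV v hv, fun hv => ?_⟩
    rw [← V.orthogonal_orthogonal]
    intro w hw
    obtain ⟨t, ht⟩ := hspan ⟨w, hw⟩
    have ht' : t • m = w := congrArg Subtype.val ht
    rw [real_inner_smul_left] at hv
    rw [← ht', real_inner_smul_left,
      (mul_eq_zero.1 hv).resolve_left (inv_ne_zero (norm_ne_zero_iff.2 hm0')), mul_zero]
  refine ⟨‖m‖⁻¹ • m, hn, hmem, ?_⟩
  generalize ‖m‖⁻¹ • m = n at hn hnV hmem
  intro v
  have hd : v - (inner ℝ n v : ℝ) • n ∈ V := by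
    rw [hmem, inner_sub_right, real_inner_smul_right, real_inner_self_eq_norm_sq, hn]
    ring
  have hv : v = (v - (inner ℝ n v : ℝ) • n) + (inner ℝ n v : ℝ) • n := by abel
  conv_lhs => rw [hv, map_add, Submodule.reflection_mem_subspace_eq_self hd, map_smul,
    Submodule.reflection_mem_subspace_orthogonalComplement_eq_neg hnV]
  module

theorem IsSector.symm {a b : AffineSubspace ℝ Plane} {S : Set Plane} (h : IsSector a b S) :
    IsSector b a S := by
  rcases h with ⟨hp, p, h1, h2, rfl⟩ | ⟨hp, rfl⟩
  · exact Or.inl ⟨fun h => hp h.symm, p, h2, h1, by simp only [and_comm]⟩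
  · refine Or.inr ⟨hp.symm, ?_⟩
    ext x
    constructor
    · rintro ⟨p, hp, q, hq, h⟩
      exact ⟨q, hq, p, hp, sbtw_comm.1 h⟩
    · rintro ⟨p, hp, q, hq, h⟩
      exact ⟨q, hq, p, hp, sbtw_comm.1 h⟩

/-- A subset of a sector or strip lies strictly on one side of the bounding lines. -/
theorem exists_isSignedDistance {a b : AffineSubspace ℝ Plane} [Nonempty a]
    (ha : IsLine a) (hb : IsLine b) (hab : a ≠ b) {S : Set Plane} (hS : IsSector a b S) :
    ∃ s n, IsSignedDistance (EuclideanGeometry.reflection a) s n ∧ (∀ x, s x = 0 ↔ x ∈ a) ∧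
      ∀ x ∈ S, 0 < s x := by
  obtain ⟨⟨p, hp⟩, hfin⟩ := ha
  obtain ⟨n, hn, hmem, hrefl⟩ := exists_unit_normal hfin
  have hzero : ∀ x, (inner ℝ n (x - p) : ℝ) = 0 ↔ x ∈ a := fun x => by
    rw [← hmem, ← vsub_eq_sub, AffineSubspace.vsub_right_mem_direction_iff_mem hp]
  -- Only the sign of e is used later: it decides which of the two unit normals points towards S.
  have hside : ∃ e : ℝ, ∀ x ∈ S, 0 < e * inner ℝ n (x - p) := by
    rcases hS with ⟨-, q, hq, -, rfl⟩ | ⟨hpar, rfl⟩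
    · refine ⟨inner ℝ n (q - p), fun x hx => ?_⟩
      obtain ⟨-, hxa, p₂, hp₂, hray⟩ := (AffineSubspace.sSameSide_iff_exists_left hp).1 hx.1
      have e2 : (inner ℝ n (x - p₂) : ℝ) = inner ℝ n (x - p) := by
        rw [← sub_eq_zero, ← inner_sub_right, sub_sub_sub_cancel_left, ← neg_sub, inner_neg_right,
          (hzero p₂).2 hp₂, neg_zero]
      obtain ⟨r₁, r₂, hr₁, hr₂, hr⟩ := hray.exists_pos
        (fun h => hq (by rw [vsub_eq_zero_iff_eq] at h; exact h ▸ hp))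
        (fun h => hxa (by rw [vsub_eq_zero_iff_eq] at h; exact h ▸ hp₂))
      have hr' := congrArg (fun z => (inner ℝ n z : ℝ)) hr
      simp only [vsub_eq_sub, real_inner_smul_right, e2] at hr'
      have hx0 : (inner ℝ n (x - p) : ℝ) ≠ 0 := fun h => hxa ((hzero x).1 h)
      have : (inner ℝ n (q - p) : ℝ) = r₂ / r₁ * inner ℝ n (x - p) := by
        field_simp
        linarith
      rw [this, mul_assoc]
      exact mul_pos (div_pos hr₂ hr₁) (mul_self_pos.2 hx0)
    · obtain ⟨⟨q₀, hq₀⟩, -⟩ := hb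
      have hconst : ∀ q ∈ b, (inner ℝ n (q - p) : ℝ) = inner ℝ n (q₀ - p) := fun q hq => by
        rw [← sub_eq_zero, ← inner_sub_right, sub_sub_sub_cancel_right, ← hmem,
          hpar.direction_eq]
        exact AffineSubspace.vsub_mem_direction hq hq₀
      -- Parallel lines with a common point coincide, so b lies at a nonzero signed distance from a.
      have hne : (inner ℝ n (q₀ - p) : ℝ) ≠ 0 := fun h0 =>
        hab (AffineSubspace.ext_of_direction_eq hpar.direction_eq ⟨q₀, (hzero q₀).1 h0, hq₀⟩)
      refine ⟨inner ℝ n (q₀ - p), ?_⟩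
      rintro x ⟨p', hp', q, hq, hx⟩
      obtain ⟨⟨t, ⟨ht0, -⟩, rfl⟩, hxp, -⟩ := hx
      have ht : 0 < t := ht0.lt_of_ne fun h => hxp (by simp [← h])
      have e1 : AffineMap.lineMap p' q t - p = (1 - t) • (p' - p) + t • (q - p) := by
        rw [AffineMap.lineMap_apply_module]
        module
      rw [e1, inner_add_right, real_inner_smul_right, real_inner_smul_right, hconst q hq,
        (hzero p').2 hp', mul_zero, zero_add]
      have := mul_self_pos.2 hne
      nlinarith [mul_pos ht this]
  have hmain : ∀ σ : ℝ, σ * σ = 1 → IsSignedDistance (EuclideanGeometry.reflection a)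
      (fun x => σ * inner ℝ n (x - p)) (σ • n) := fun σ hσ => by
    have hσ1 : |σ| = 1 := by
      rcases mul_self_eq_one_iff.1 hσ with h | h <;> simp [h]
    refine ⟨?_, fun x t => ?_, fun x => ?_, ?_⟩
    · refine LipschitzWith.of_dist_le_mul fun x y => ?_
      rw [Real.dist_eq, ← mul_sub, ← inner_sub_right, sub_sub_sub_cancel_right, abs_mul, hσ1,
        one_mul, NNReal.coe_one, one_mul, dist_eq_norm]
      have := abs_real_inner_le_norm n (x - y)
      rwa [hn, one_mul] at this
    · rw [smul_smul, add_sub_right_comm, inner_add_right, real_inner_smul_right,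
        real_inner_self_eq_norm_sq, hn]
      linear_combination t * hσ
    · rw [EuclideanGeometry.reflection_apply_of_mem a x hp, hrefl, smul_smul]
      have : 2 * (σ * inner ℝ n (x - p)) * σ = 2 * inner ℝ n (x - p) := by
        linear_combination 2 * inner ℝ n (x - p) * hσ
      rw [this, vadd_eq_add, vsub_eq_sub]
      abel
    · have hset : {x | σ * inner ℝ n (x - p) = 0} = (a : Set Plane) := by
        ext x
        have hσ0 : σ ≠ 0 := fun h => by simp [h] at hσ
        simpa [hσ0] using hzero x
      rw [hset]
      refine Measure.addHaar_affineSubspace volume a fun htop => ?_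
      rw [htop, AffineSubspace.direction_top, finrank_top, finrank_euclideanSpace_fin] at hfin
      omega
  obtain ⟨e, he⟩ := hside
  rcases le_or_gt 0 e with he0 | he0
  · refine ⟨_, _, hmain 1 (by norm_num), fun x => by simpa using hzero x, fun x hx => ?_⟩
    rw [one_mul]
    exact pos_of_mul_pos_right (he x hx) he0
  · refine ⟨_, _, hmain (-1) (by norm_num), fun x => by simpa using hzero x, fun x hx => ?_⟩
    have := he x hx
    nlinarith [neg_pos.2 (neg_of_mul_pos_right this he0.le)]

theorem closure_inter_eq_sideOn {a : AffineSubspace ℝ Plane} {K : Set Plane} {s : Plane → ℝ}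
    (hs : ∀ x, s x = 0 ↔ x ∈ a) (hK : ∀ x ∈ K, 0 < s x) (hKo : IsOpen K) :
    closure K ∩ {x | s x = 0} = sideOn a K := by
  ext x
  rw [sideOn, hKo.frontier_eq]
  constructor
  · rintro ⟨h1, h2⟩
    exact ⟨⟨h1, fun h => (hK x h).ne' h2⟩, (hs x).1 h2⟩
  · rintro ⟨⟨h1, -⟩, h2⟩
    exact ⟨h1, (hs x).2 h2⟩

theorem isClosed_sideOn (a : AffineSubspace ℝ Plane) (K : Set Plane) : IsClosed (sideOn a K) :=
  isClosed_frontier.inter a.closed_of_finiteDimensional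

theorem apply_mem_closure_mirror (a : AffineSubspace ℝ Plane) [Nonempty a] {X : Set Plane}
    {x : Plane} (hx : x ∈ closure X) : EuclideanGeometry.reflection a x ∈ closure (mirror a X) :=
  map_mem_closure (EuclideanGeometry.reflection a).continuous hx fun y hy => ⟨y, hy, rfl⟩

theorem apply_mem_closure_of_mem_closure_mirror (a : AffineSubspace ℝ Plane) [Nonempty a]
    {X : Set Plane} {x : Plane} (hx : x ∈ closure (mirror a X)) :
    EuclideanGeometry.reflection a x ∈ closure X := by
  refine map_mem_closure (EuclideanGeometry.reflection a).continuous hx ?_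
  rintro _ ⟨y, hy, rfl⟩
  rwa [EuclideanGeometry.reflection_reflection]

theorem gradient_linear_combination {f g : Plane → ℝ} (hf : Differentiable ℝ f)
    (hg : Differentiable ℝ g) (c d : ℝ) :
    gradient (c • f + d • g) = c • gradient f + d • gradient g := by
  ext1 x
  simp only [gradient, Pi.add_apply, Pi.smul_apply]
  rw [fderiv_add ((hf x).const_smul c) ((hg x).const_smul d), fderiv_const_smul (hf x),
    fderiv_const_smul (hg x), map_add, map_smul, map_smul]

/-! ### Transplantation -/

namespace MixedProblem

variable {P Q : MixedProblem}

theorem IsUnfolding.testPair {T : Plane ≃ᵃⁱ[ℝ] Plane} {G : Set Plane} {J J'}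
    (hJ : P.IsUnfolding T G J J') {p : P.L2 × P.L2Field} (hp : p ∈ P.testPairs) :
    ∃ φ : Plane → ℝ, ContDiff ℝ ∞ φ ∧ HasCompactSupport φ ∧
      Disjoint (tsupport φ) (closure P.dirichlet) ∧
      ((J p.1).1 =ᵐ[volume.restrict G] φ ∧
        (J p.1).2 =ᵐ[volume.restrict G] fun x => φ (T x)) ∧
      (J' p.2).1 =ᵐ[volume.restrict G] gradient φ ∧
        (J' p.2).2 =ᵐ[volume.restrict G] gradient fun x => φ (T x) := by
  obtain ⟨φ, h1, h2, h3, h4, h5⟩ := hp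
  exact ⟨φ, h1, h2, h3, hJ.scalar _ _ h4, hJ.field _ _ h5⟩

theorem Lp_eq_linear_combination {F : Type*} [NormedAddCommGroup F] [NormedSpace ℝ F]
    {μ : Measure Plane} {x y z : Lp F 2 μ} {f g k : Plane → F} {c d : ℝ} (hx : x =ᵐ[μ] f)
    (hy : y =ᵐ[μ] g) (hz : z =ᵐ[μ] k) (hk : k = c • f + d • g) : z = c • x + d • y := by
  refine Lp.ext ?_
  filter_upwards [hx, hy, hz, Lp.coeFn_add (c • x) (d • y), Lp.coeFn_smul c x, Lp.coeFn_smul d y]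
    with t h1 h2 h3 h4 h5 h6
  rw [h3, h4, Pi.add_apply, h5, h6, hk]
  simp only [Pi.add_apply, Pi.smul_apply, h1, h2]

set_option maxHeartbeats 1000000 in
/-- Transplantation of a test function: linear combinations of the two halves of a test function of
`P` are the two halves of an element of the form domain of `Q`. -/
theorem IsUnfolding.transplant {T S : Plane ≃ᵃⁱ[ℝ] Plane} {K : Set Plane} {J J' I I'}
    (hJ : P.IsUnfolding T (interior (closure K)) J J')
    (hI : Q.IsUnfolding S (interior (closure K)) I I') {s : Plane → ℝ} {n : Plane}
    (h : IsSignedDistance S s n) (hK : ∀ x ∈ K, 0 < s x) (hb : Bornology.IsBounded K)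
    (hdom : Q.domain = interior (closure (K ∪ S '' K))) (α β γ δ : ℝ)
    (hd : ∀ φ : Plane → ℝ, Disjoint (tsupport φ) (closure P.dirichlet) →
      Disjoint (tsupport ((α - γ) • φ + (β - δ) • fun x => φ (T x)))
        (closure K ∩ {x | s x = 0}))
    (hdir : ∀ φ : Plane → ℝ, (∀ x ∈ closure P.dirichlet, φ x = 0) → ∀ x ∈ closure Q.dirichlet,
      (x ∈ closure K ∧ α * φ x + β * φ (T x) = 0) ∨
        (S x ∈ closure K ∧ γ * φ (S x) + δ * φ (T (S x)) = 0))
    {p : P.L2 × P.L2Field} (hp : p ∈ P.testPairs) :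
    ∃ q ∈ Q.formDomain,
      I q.1 = (α • (J p.1).1 + β • (J p.1).2, γ • (J p.1).1 + δ • (J p.1).2) ∧
      I' q.2 = (α • (J' p.2).1 + β • (J' p.2).2, γ • (J' p.2).1 + δ • (J' p.2).2) := by
  obtain ⟨φ, hφ, hφc, hφd, ⟨k1, k2⟩, k3, k4⟩ := hJ.testPair hp
  obtain ⟨C, hC⟩ := hφ.lipschitzWith_of_hasCompactSupport hφc (by simp)
  have hCT : LipschitzWith (C * 1) fun x => φ (T x) := hC.comp T.isometry.lipschitz
  have hD : Differentiable ℝ φ := hφ.differentiable (by simp)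
  have hDT : Differentiable ℝ fun x => φ (T x) := by
    rw [affineIsometryEquiv_eq_add T]
    exact hD.comp (T.linearIsometryEquiv.differentiable.add_const _)
  have hL : ∀ c d : ℝ, ∃ C', LipschitzWith C' (c • φ + d • fun x => φ (T x)) := fun c d =>
    ⟨_, ((lipschitzWith_smul c).comp hC).add ((lipschitzWith_smul d).comp hCT)⟩
  obtain ⟨C₁, h₁⟩ := hL α β
  obtain ⟨C₂, h₂⟩ := hL γ δ
  have hsub : (α • φ + β • fun x => φ (T x)) - (γ • φ + δ • fun x => φ (T x)) =
      (α - γ) • φ + (β - δ) • fun x => φ (T x) := by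
    module
  obtain ⟨q, hq, ⟨q1, q2⟩, q3, q4⟩ := hI.exists_mem_formDomain h hK hb hdom h₁ h₂
    (hsub ▸ hd φ hφd)
    (hdir φ fun x hx => image_eq_zero_of_notMem_tsupport fun hx' =>
      Set.disjoint_left.1 hφd hx' hx)
  exact ⟨q, hq,
    Prod.ext (Lp_eq_linear_combination k1 k2 q1 rfl) (Lp_eq_linear_combination k1 k2 q2 rfl),
    Prod.ext (Lp_eq_linear_combination k3 k4 q3 (gradient_linear_combination hD hDT _ _))
      (Lp_eq_linear_combination k3 k4 q4 (gradient_linear_combination hD hDT _ _))⟩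

end MixedProblem

/-- The support of ψ lies in the preimage under T of that of φ. This supplies the gluing condition,
with T the reflection in a in one direction and the identity in the other. -/
theorem disjoint_tsupport_of_forall_mem {φ ψ : Plane → ℝ} {D E : Set Plane}
    (T : Plane ≃ᵃⁱ[ℝ] Plane) (hφ : Disjoint (tsupport φ) (closure D))
    (hψ : ∀ x, φ (T x) = 0 → ψ x = 0) (hE : ∀ x ∈ E, T x ∈ closure D) :
    Disjoint (tsupport ψ) E := by
  have hsub : tsupport ψ ⊆ T ⁻¹' tsupport φ :=
    closure_minimal (fun x hx => subset_tsupport φ fun h0 => hx (hψ x h0))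
      ((isClosed_tsupport φ).preimage T.continuous)
  exact Set.disjoint_left.2 fun x hx hxE => Set.disjoint_left.1 hφ (hsub hx) (hE x hxE)

theorem theorem3p1 (a b : AffineSubspace ℝ Plane) [Nonempty a] [Nonempty b]
    (ha : IsLine a) (hb : IsLine b) (hab : a ≠ b)
    (K : Set Plane) (hK : IsConstructionBlock a b K)
    (D₀ N₀ : Set Plane) (hcover : D₀ ∪ N₀ = remainingBoundary a b K) (hdisj : Disjoint D₀ N₀) :
    MixedProblem.Isospectral (firstProblem a b K D₀ N₀) (secondProblem a b K D₀ N₀) := by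
  obtain ⟨S, hS, hKS⟩ := hK.subset_sector
  obtain ⟨s, n, hs, hs0, hsS⟩ := exists_isSignedDistance ha hb hab hS
  obtain ⟨t, m, ht, ht0, htS⟩ := exists_isSignedDistance hb ha hab.symm hS.symm
  have hsK : ∀ x ∈ K, 0 < s x := fun x hx => hsS x (hKS hx)
  have htK : ∀ x ∈ K, 0 < t x := fun x hx => htS x (hKS hx)
  have hsideA := closure_inter_eq_sideOn hs0 hsK hK.isOpen
  have hsideB := closure_inter_eq_sideOn ht0 htK hK.isOpen
  have hD₀ : closure D₀ ⊆ closure K :=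
    closure_minimal (fun x hx => frontier_subset_closure
      ((hcover.subset (Or.inl hx) : x ∈ remainingBoundary a b K).1)) isClosed_closure
  have hPd : closure (firstProblem a b K D₀ N₀).dirichlet =
      closure D₀ ∪ closure (mirror a D₀) ∪ closure (mirror a (sideOn b K)) := by
    rw [← closure_union, ← closure_union]; rfl
  have hQd : closure (secondProblem a b K D₀ N₀).dirichlet =
      closure D₀ ∪ closure (mirror b D₀) ∪ sideOn a K := by
    rw [← (isClosed_sideOn a K).closure_eq, ← closure_union, ← closure_union]; rfl
  obtain ⟨J, J', hJ⟩ := MixedProblem.exists_isUnfolding (P := firstProblem a b K D₀ N₀) hs hsK rfl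
  obtain ⟨I, I', hI⟩ := MixedProblem.exists_isUnfolding (P := secondProblem a b K D₀ N₀) ht htK rfl
  let U := (J.trans (eighthRotation _)).trans I.symm
  let V := (J'.trans (eighthRotation _)).trans I'.symm
  have hU : ∀ u v, inner ℝ (U u) (U v) = inner ℝ u v := fun u v => by
    rw [hI.inner_scalar, hJ.inner_scalar]
    simp only [U, LinearEquiv.trans_apply, LinearEquiv.apply_symm_apply]
    exact inner_eighthRotation _ _
  have hV : ∀ u v, inner ℝ (V u) (V v) = inner ℝ u v := fun u v => by
    rw [hI.inner_field, hJ.inner_field]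
    simp only [V, LinearEquiv.trans_apply, LinearEquiv.apply_symm_apply]
    exact inner_eighthRotation _ _
  refine MixedProblem.isospectral_of_isometry (U.isometryOfInner hU) (V.isometryOfInner hV)
    (fun p hp => ?_) (fun q hq => ?_)
  -- With these coefficients the new halves differ by -√2 φ ∘ T_a, which vanishes near ∂_b K because
  -- φ vanishes near T_a(∂_b K).
  · refine Exists.elim (hJ.transplant hI ht htK hK.isBounded rfl
      (√2)⁻¹ (-(√2)⁻¹) (√2)⁻¹ (√2)⁻¹ (fun φ hφ => ?_) (fun φ hφ x hx => ?_) hp) ?_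
    · rw [hsideB]
      refine disjoint_tsupport_of_forall_mem (EuclideanGeometry.reflection a) hφ
        (fun x hx => by simp [hx]) fun x hx => ?_
      rw [hPd]
      exact Or.inr (apply_mem_closure_mirror a (subset_closure hx))
    · rw [hPd] at hφ
      have hz : ∀ y ∈ closure D₀, φ y = 0 ∧ φ (EuclideanGeometry.reflection a y) = 0 :=
        fun y hy => ⟨hφ y (Or.inl (Or.inl hy)),
          hφ _ (Or.inl (Or.inr (apply_mem_closure_mirror a hy)))⟩
      rw [hQd] at hx
      rcases hx with (hx | hx) | hx
      · exact Or.inl ⟨hD₀ hx, by simp [hz x hx]⟩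
      · have hx' := apply_mem_closure_of_mem_closure_mirror b hx
        exact Or.inr ⟨hD₀ hx', by simp [hz _ hx']⟩
      -- Points of ∂_a K are fixed by the reflection in a, so the first half φ - φ ∘ T_a is zero
      -- there.
      · rw [← hsideA] at hx
        exact Or.inl ⟨hx.1, by rw [hs.apply_eq_self hx.2]; ring⟩
    · rintro q ⟨hq, hq1, hq2⟩
      convert hq
      · change I.symm (eighthRotation _ (J p.1)) = q.1
        rw [LinearEquiv.symm_apply_eq, hq1]
        ext1 <;> simp only [eighthRotation, LinearEquiv.coe_mk, LinearMap.coe_mk,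
          AddHom.coe_mk] <;> module
      · change I'.symm (eighthRotation _ (J' p.2)) = q.2
        rw [LinearEquiv.symm_apply_eq, hq2]
        ext1 <;> simp only [eighthRotation, LinearEquiv.coe_mk, LinearMap.coe_mk,
          AddHom.coe_mk] <;> module
  -- The inverse rotation: the halves differ by √2 φ, which vanishes near ∂_a K, a Dirichlet part of
  -- the second problem.
  · refine Exists.elim (hI.transplant hJ hs hsK hK.isBounded rfl
      (√2)⁻¹ (√2)⁻¹ (-(√2)⁻¹) (√2)⁻¹ (fun φ hφ => ?_) (fun φ hφ x hx => ?_) hq) ?_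
    · rw [hsideA]
      refine disjoint_tsupport_of_forall_mem (AffineIsometryEquiv.refl ℝ Plane) hφ
        (fun x hx => ?_) fun x hx => ?_
      · have hx' : φ x = 0 := hx
        simp [hx']
      · rw [hQd]
        exact Or.inr hx
    · rw [hQd] at hφ
      have hz : ∀ y ∈ closure D₀, φ y = 0 ∧ φ (EuclideanGeometry.reflection b y) = 0 :=
        fun y hy => ⟨hφ y (Or.inl (Or.inl hy)),
          hφ _ (Or.inl (Or.inr (apply_mem_closure_mirror b hy)))⟩
      rw [hPd] at hx
      rcases hx with (hx | hx) | hx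
      · exact Or.inl ⟨hD₀ hx, by simp [hz x hx]⟩
      · have hx' := apply_mem_closure_of_mem_closure_mirror a hx
        exact Or.inr ⟨hD₀ hx', by simp [hz _ hx']⟩
      -- The reflected point lies on b and is fixed by T_b, so the second half φ ∘ T_b - φ vanishes
      -- there.
      · have hx' := apply_mem_closure_of_mem_closure_mirror a hx
        rw [(isClosed_sideOn b K).closure_eq, ← hsideB] at hx'
        exact Or.inr ⟨hx'.1, by rw [ht.apply_eq_self hx'.2]; ring⟩
    · rintro p ⟨hp, hp1, hp2⟩
      convert hp
      · change J.symm ((eighthRotation _).symm (I q.1)) = p.1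
        rw [LinearEquiv.symm_apply_eq, hp1]
        ext1 <;> simp only [eighthRotation, LinearEquiv.coe_symm_mk] <;> module
      · change J'.symm ((eighthRotation _).symm (I' q.2)) = p.2
        rw [LinearEquiv.symm_apply_eq, hp2]
        ext1 <;> simp only [eighthRotation, LinearEquiv.coe_symm_mk] <;> module
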